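/- Let $n\ge 1$ and $p\ge 2$ be integers, let $\mathcal S_n$ be the set of permutations of $[n]=\{1,\dots,n\}$, let $E=\binom{[n]}{2}$ be the set of unordered pairs of distinct elements of $[n]$, let $N=|E|$, and let $\rho\in[0,1]$. Let $\pi^\star=(\pi^\star_1,\dots,\pi^\star_p)$ be uniform on $(\mathcal S_n)^p$, let $H=(H_e)_{e\in E}$ and $Z=(Z_{je})_{j\in[p],e\in E}$ have i.i.d. $\mathcal N(0,1)$ entries, with $\pi^\star,H,Z$ independent, and observe $$G_{je}=\sqrt{\rho}\,H_{\Pi^\star_j(e)}+\sqrt{1-\rho}\,Z_{je},\qquad j\in[p],\ e\in E,$$ where, for $\pi\in(\mathcal S_n)^p$ and $e=\{u,v\}\in E$, $\Pi_j(e)=\{\pi_j(u),\pi_j(v)\}$. For $\pi\in(\mathcal S_n)^p$ let also $\Pi\in\mathbb R^{pN\times pN}$ denote the block matrix $\Pi_{je,j'e'}=\mathbf 1\{j=j'\}\mathbf 1\{\Pi_j(e)=e'\}$, and let $J_p$ be the $p\times p$ all-ones matrix. Viewing $G$ as a vector of $\mathbb R^{pN}$, let $\widehat\pi$ be the maximum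 likelihood estimator (MLE), i.e. $$\widehat\pi\in\operatorname*{arg\,max}_{\pi\in(\mathcal S_n)^p}\ G^T\,\Pi\,(J_p\otimes I_N)\,\Pi^T\,G .$$ For $\pi\in(\mathcal S_n)^p$ put $$\mathrm{err}(\pi,\pi^\star)=\min_{\psi\in\mathcal S_n}\frac1{np}\sum_{u=1}^n\sum_{j=1}^p\mathbf 1\{\psi(\pi_j(u))\neq\pi^\star_j(u)\}.$$ There exist numerical constants $c_1>0$ and $n_0$ such that the following holds. Whenever $n\ge n_0$, $p\ge2$, $\rho\in[0,1]$ and $$\rho\ \ge\ c_1\left(\frac{\log(np)}{n}\vee\sqrt{\frac{\log(np)}{np}}\right),$$ then with probability at least $1-1/(np)^2$ the MLE achieves exact recovery, $\mathrm{err}(\widehat\pi,\pi^\star)=0$, for every choice of the maximizer $\widehat\pi$. -/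

import Mathlib

open MeasureTheory ProbabilityTheory
open scoped Kronecker Matrix

noncomputable section

namespace GaussianAlignment

/-- The edge set `E` of the complete graph on `[n]`: unordered pairs of distinct nodes. -/
abbrev Edge (n : ℕ) : Type := {e : Sym2 (Fin n) // ¬ e.IsDiag}

/-- `p`-tuples of permutations of `[n]`. -/
abbrev PermTuple (n p : ℕ) : Type := Fin p → Equiv.Perm (Fin n)

/-- The edge weights `(G_{je})` of `p` weighted complete graphs on `[n]`, seen as a vector. -/
abbrev Weights (n p : ℕ) : Type := Fin p × Edge n → ℝ

/-- The action `{u, v} ↦ {σ u, σ v}` of a node permutation on edges. -/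
def edgeMap {n : ℕ} (σ : Equiv.Perm (Fin n)) (e : Edge n) : Edge n :=
  ⟨Sym2.map σ e.1, fun h => e.2 ((Sym2.isDiag_map σ.injective).1 h)⟩

/-- The proportion of misclassified points, up to a global relabelling `ψ`. -/
def err {n p : ℕ} (π π' : PermTuple n p) : ℝ :=
  Finset.univ.inf' Finset.univ_nonempty fun ψ : Equiv.Perm (Fin n) =>
    (1 / ((n : ℝ) * (p : ℝ))) *
      ∑ u : Fin n, ∑ j : Fin p, if ψ (π j u) ≠ π' j u then (1 : ℝ) else 0

/-! The model. -/

/-- The observation `G_{je} = √ρ H_{Π_j(e)} + √(1-ρ) Z_{je}`. -/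
def observation {n p : ℕ} (ρ : ℝ) (π : PermTuple n p) (H : Edge n → ℝ) (Z : Weights n p) :
    Weights n p :=
  fun a => √ρ * H (edgeMap (π a.1) a.2) + √(1 - ρ) * Z a

/-- Node permutations form a finite discrete space. -/
instance instMeasurableSpacePerm (n : ℕ) : MeasurableSpace (Equiv.Perm (Fin n)) := ⊤

instance instDiscreteMeasurableSpacePerm (n : ℕ) :
    DiscreteMeasurableSpace (Equiv.Perm (Fin n)) := ⟨fun _ => trivial⟩

/-- The law of a family of i.i.d. standard Gaussian variables. -/
def stdGaussianFamily (ι : Type) [Fintype ι] : Measure (ι → ℝ) :=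
  Measure.pi fun _ => gaussianReal 0 1

instance instProbStdGaussianFamily (ι : Type) [Fintype ι] :
    IsProbabilityMeasure (stdGaussianFamily ι) := by
  unfold stdGaussianFamily
  infer_instance

/-- The joint law of `(π⋆, (G_1, …, G_p))`: `π⋆` is uniform on `(S_n)^p`, the signal `H` and the
noise `Z` have i.i.d. standard Gaussian entries, and `π⋆`, `H`, `Z` are independent. -/
def modelLaw (n p : ℕ) (ρ : ℝ) : Measure (PermTuple n p × Weights n p) :=
  Measure.map
    (fun ω : PermTuple n p × (Edge n → ℝ) × Weights n p =>
      (ω.1, observation ρ ω.1 ω.2.1 ω.2.2))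
    ((uniformOn (Set.univ : Set (PermTuple n p))).prod
      ((stdGaussianFamily (Edge n)).prod (stdGaussianFamily (Fin p × Edge n))))

theorem measurable_sampling (n p : ℕ) (ρ : ℝ) :
    Measurable (fun ω : PermTuple n p × (Edge n → ℝ) × Weights n p =>
      (ω.1, observation ρ ω.1 ω.2.1 ω.2.2)) := by
  refine Measurable.prodMk measurable_fst ?_
  refine measurable_from_prod_countable_right (fun π => ?_)
  refine measurable_pi_lambda _ (fun a => ?_)
  have h1 : Measurable fun y : (Edge n → ℝ) × Weights n p => y.1 (edgeMap (π a.1) a.2) :=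
    (measurable_pi_apply _).comp measurable_fst
  have h2 : Measurable fun y : (Edge n → ℝ) × Weights n p => y.2 a :=
    (measurable_pi_apply _).comp measurable_snd
  exact (h1.const_mul _).add (h2.const_mul _)

instance instProbModelLaw (n p : ℕ) (ρ : ℝ) : IsProbabilityMeasure (modelLaw n p ρ) := by
  unfold modelLaw
  exact Measure.isProbabilityMeasure_map (measurable_sampling n p ρ).aemeasurable

/-! The maximum likelihood estimator. -/

/-- The block matrix `Π_{je,j'e'} = 1{j = j'} 1{Π_j(e) = e'}`. -/
def blockPerm {n p : ℕ} (π : PermTuple n p) : Matrix (Fin p × Edge n) (Fin p × Edge n) ℝ :=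
  Matrix.of fun a b => if a.1 = b.1 ∧ edgeMap (π a.1) a.2 = b.2 then 1 else 0

/-- The `p × p` matrix `J_p` all of whose entries are `1`. -/
def onesMatrix (p : ℕ) : Matrix (Fin p) (Fin p) ℝ := Matrix.of fun _ _ => 1

/-- `Gᵀ Π (J_p ⊗ I_N) Πᵀ G`. -/
def mleObjective {n p : ℕ} (G : Weights n p) (π : PermTuple n p) : ℝ :=
  G ⬝ᵥ ((blockPerm π * (onesMatrix p ⊗ₖ (1 : Matrix (Edge n) (Edge n) ℝ)) * (blockPerm π)ᵀ) *ᵥ G)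

/-- `π` is a maximum likelihood estimate of `π⋆` from the observation `G`:
`π ∈ argmax_π Gᵀ Π (J_p ⊗ I_N) Πᵀ G`. -/
def IsMLE {n p : ℕ} (G : Weights n p) (π : PermTuple n p) : Prop :=
  ∀ π' : PermTuple n p, mleObjective G π' ≤ mleObjective G π

theorem exists_isMLE {n p : ℕ} (G : Weights n p) : ∃ π : PermTuple n p, IsMLE G π :=
  Finite.exists_max (mleObjective G)

/-- The conditional covariance matrix `Σ(π) = Π [(ρ J_p + (1-ρ) I_p) ⊗ I_N] Πᵀ` of `G`. -/
def covMatrix {n p : ℕ} (ρ : ℝ) (π : PermTuple n p) :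
    Matrix (Fin p × Edge n) (Fin p × Edge n) ℝ :=
  blockPerm π * ((ρ • onesMatrix p + (1 - ρ) • (1 : Matrix (Fin p) (Fin p) ℝ)) ⊗ₖ
    (1 : Matrix (Edge n) (Edge n) ℝ)) * (blockPerm π)ᵀ

theorem edgeMap_injective {n : ℕ} (σ : Equiv.Perm (Fin n)) : Function.Injective (edgeMap σ) := by
  intro e f h
  exact Subtype.ext (Sym2.map.injective σ.injective (congrArg Subtype.val h))

theorem blockPerm_mul_transpose {n p : ℕ} (π : PermTuple n p) :
    blockPerm π * (blockPerm π)ᵀ = 1 := by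
  ext ⟨j, e⟩ ⟨k, f⟩
  rw [Matrix.mul_apply, Finset.sum_eq_single (j, edgeMap (π j) e)]
  · by_cases h : j = k
    · subst h
      simp [blockPerm, Matrix.one_apply, (edgeMap_injective (π j)).eq_iff, eq_comm]
    · have h' : ¬ k = j := fun h2 => h h2.symm
      simp [blockPerm, h, h']
  · rintro ⟨l, g⟩ - hne
    have : ¬ (j = l ∧ edgeMap (π j) e = g) := by
      rintro ⟨rfl, rfl⟩; exact hne rfl
    simp [blockPerm, this]
  · simp

/-- For `0 < ρ < 1` the matrix `Σ(π)` is invertible, and being a maximum likelihood estimate is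
the same as minimizing `Gᵀ Σ(π)⁻¹ G`, that is, maximizing the Gaussian likelihood. -/
theorem isMLE_iff {n p : ℕ} {ρ : ℝ} (h0 : 0 < ρ) (h1 : ρ < 1) (G : Weights n p)
    (π : PermTuple n p) :
    IsMLE G π ↔ ∀ π' : PermTuple n p,
      G ⬝ᵥ ((covMatrix ρ π)⁻¹ *ᵥ G) ≤ G ⬝ᵥ ((covMatrix ρ π')⁻¹ *ᵥ G) := by
  have h1' : 0 < 1 - ρ := by linarith
  have hp : 0 < 1 - ρ + ρ * p := by positivity
  have key : ∀ π' : PermTuple n p, G ⬝ᵥ ((covMatrix ρ π')⁻¹ *ᵥ G) =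
      (1 - ρ)⁻¹ * (G ⬝ᵥ G) - ρ / ((1 - ρ) * (1 - ρ + ρ * p)) * mleObjective G π' := by
    intro π'
    set M := blockPerm π' * (onesMatrix p ⊗ₖ (1 : Matrix (Edge n) (Edge n) ℝ)) *
      (blockPerm π')ᵀ with hM
    have hcov : covMatrix ρ π' = ρ • M + (1 - ρ) • 1 := by
      rw [covMatrix, hM, Matrix.add_kronecker, Matrix.smul_kronecker, Matrix.smul_kronecker,
        Matrix.one_kronecker_one, Matrix.mul_add, Matrix.add_mul]
      simp [blockPerm_mul_transpose]
    have hPt : (blockPerm π')ᵀ * blockPerm π' = 1 :=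
      mul_eq_one_comm.1 (blockPerm_mul_transpose π')
    have hJ : onesMatrix p * onesMatrix p = (p : ℝ) • onesMatrix p := by
      ext i j
      simp [onesMatrix, Matrix.mul_apply]
    have hMM : M * M = (p : ℝ) • M := by
      calc M * M = blockPerm π' * (onesMatrix p ⊗ₖ (1 : Matrix (Edge n) (Edge n) ℝ)) *
            ((blockPerm π')ᵀ * blockPerm π') *
            (onesMatrix p ⊗ₖ (1 : Matrix (Edge n) (Edge n) ℝ)) * (blockPerm π')ᵀ := by
            simp only [hM, Matrix.mul_assoc]
        _ = blockPerm π' * ((onesMatrix p ⊗ₖ (1 : Matrix (Edge n) (Edge n) ℝ)) *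
            (onesMatrix p ⊗ₖ (1 : Matrix (Edge n) (Edge n) ℝ))) * (blockPerm π')ᵀ := by
            rw [hPt, Matrix.mul_one]; simp only [Matrix.mul_assoc]
        _ = (p : ℝ) • M := by
            rw [← Matrix.mul_kronecker_mul, hJ, Matrix.mul_one, Matrix.smul_kronecker]
            simp [hM]
    have hinv : (covMatrix ρ π')⁻¹ =
        (1 - ρ)⁻¹ • 1 - (ρ / ((1 - ρ) * (1 - ρ + ρ * p))) • M := by
      apply Matrix.inv_eq_right_inv
      rw [hcov]
      simp only [Matrix.mul_sub, Matrix.add_mul, Matrix.smul_mul, Matrix.mul_smul, Matrix.mul_one,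
        Matrix.one_mul, hMM, smul_add, smul_smul]
      have e1 : (1 - ρ)⁻¹ * (1 - ρ) = 1 := by field_simp
      rw [e1, one_smul]
      have e2 : (1 - ρ)⁻¹ * ρ = ρ / ((1 - ρ) * (1 - ρ + ρ * p)) * (ρ * p) +
          ρ / ((1 - ρ) * (1 - ρ + ρ * p)) * (1 - ρ) := by
        field_simp
        ring
      rw [e2, add_smul]
      abel
    rw [hinv, Matrix.sub_mulVec, dotProduct_sub]
    simp [Matrix.smul_mulVec, mleObjective, hM]
  have hk : 0 < ρ / ((1 - ρ) * (1 - ρ + ρ * p)) := by positivity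
  unfold IsMLE
  refine forall_congr' fun π' => ?_
  rw [key, key, sub_le_sub_iff_left, mul_le_mul_iff_right₀ hk]

end GaussianAlignment

end

namespace GaussianAlignment

/-! Fix the truth `π'` and a competitor `π`. The gap between their objectives is a quadratic form in
the observation, with matrix `discrepancy π π'` (`mleObjective_sub_mleObjective`). It splits into a
drift `-ρD/2`, a Gaussian term linear in `Z`, and a centred quadratic form in `Z`. Here `D` is the
sum over pairs of graphs of `‖H - H ∘ σ‖²`, with `σ` the relative misalignment of the pair.

Outside a rare set of signals, `D` is at least half the number `M` of moved edges (`goodSignals`).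
This event concerns single permutations, so its union bound runs over `n!` terms and not `(n!)^p`.
Given such a signal, the linear term has variance at most `4ρpD`, and the quadratic one has operator
norm at most `p` and squared Frobenius norm at most `2M`. Chernoff bounds then make both unlikely to
offset the drift (`measureReal_mleObjective_le`).

The objective ignores a common relabelling, so `π` may be taken optimally labelled. Comparing with
the relabellings that align one graph exactly gives `M ≥ npd/4`, where `d` is the number of
misclassified points (`mul_mismatch_le`). Hence `π` wins with probability at most `2q^d`, where `q =
(np)^(-10)`. The generating function `∑ q^d` is at most `exp(pn²q)` (`sum_pow_mismatch_le`), which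
closes the union bound. -/

/-! ### Chernoff bounds for Gaussian quadratic and linear forms. -/

/-- This is `-log (1 - y) ≤ y + y²`, used at `y = 2a` to bound the chi-square factor `(1 -
2a)^(-1/2)`. -/
theorem one_le_one_sub_mul_exp {y : ℝ} (h2 : y ≤ 1 / 2) :
    1 ≤ (1 - y) * Real.exp (y + y ^ 2) := by
  rcases le_total 0 y with h | h
  · have := Real.quadratic_le_exp_of_nonneg (x := y + y ^ 2) (by positivity)
    have h3 : 1 ≤ (1 - y) * (1 + (y + y ^ 2) + (y + y ^ 2) ^ 2 / 2) := by
      nlinarith [pow_nonneg h 2, pow_nonneg h 3, pow_nonneg h 4,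
        mul_nonneg (pow_nonneg h 2) (sub_nonneg.2 h2), mul_nonneg (pow_nonneg h 3) (sub_nonneg.2 h2),
        mul_nonneg (pow_nonneg h 4) (sub_nonneg.2 h2)]
    exact h3.trans (mul_le_mul_of_nonneg_left this (by linarith))
  · have := Real.add_one_le_exp (y + y ^ 2)
    have h3 : 1 ≤ (1 - y) * (y + y ^ 2 + 1) := by
      nlinarith [mul_nonneg (sq_nonneg y) (neg_nonneg.2 h)]
    exact h3.trans (mul_le_mul_of_nonneg_left this (by linarith))

theorem gaussianPDFReal_smul_exp_sq (a x : ℝ) :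
    gaussianPDFReal 0 1 x • Real.exp (a * x ^ 2) =
      (√(2 * Real.pi))⁻¹ * Real.exp (-(1 / 2 - a) * x ^ 2) := by
  rw [gaussianPDFReal, smul_eq_mul, mul_assoc, ← Real.exp_add]
  congr 2
  · simp
  · simp; ring

theorem integrable_exp_mul_sq {a : ℝ} (h2 : a ≤ 1 / 4) :
    Integrable (fun x : ℝ => Real.exp (a * x ^ 2)) (gaussianReal 0 1) := by
  rw [gaussianReal_of_var_ne_zero _ one_ne_zero,
    integrable_withDensity_iff_integrable_smul' (measurable_gaussianPDF 0 1)
      (Filter.Eventually.of_forall fun x => gaussianPDF_lt_top)]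
  simp_rw [toReal_gaussianPDF, gaussianPDFReal_smul_exp_sq]
  exact (integrable_exp_neg_mul_sq (by linarith)).const_mul _

theorem integral_exp_mul_sq_le {a : ℝ} (h2 : a ≤ 1 / 4) :
    ∫ x, Real.exp (a * x ^ 2) ∂(gaussianReal 0 1) ≤ Real.exp (a + 2 * a ^ 2) := by
  rw [integral_gaussianReal_eq_integral_smul one_ne_zero]
  simp_rw [gaussianPDFReal_smul_exp_sq]
  rw [integral_const_mul, integral_gaussian, ← Real.sqrt_inv, ← Real.sqrt_mul (by positivity)]
  apply Real.sqrt_le_iff.2 ⟨(Real.exp_pos _).le, ?_⟩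
  have h := one_le_one_sub_mul_exp (y := 2 * a) (by linarith)
  have e : Real.exp (a + 2 * a ^ 2) ^ 2 = Real.exp (2 * a + (2 * a) ^ 2) := by
    rw [← Real.exp_nat_mul]; congr 1; push_cast; ring
  have e2 : (2 * Real.pi)⁻¹ * (Real.pi / (1 / 2 - a)) = 1 / (1 - 2 * a) := by
    have := Real.pi_pos
    have : 1 - 2 * a ≠ 0 := by linarith
    have : 1 / 2 - a ≠ 0 := by linarith
    field_simp
  rw [e, e2, div_le_iff₀ (by linarith), mul_comm]
  exact h

/-- The law of a standard Gaussian family is invariant under orthogonal changes of basis. -/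
theorem map_stdGaussianFamily_orthonormalBasis {ι : Type} [Fintype ι]
    (b : OrthonormalBasis ι ℝ (EuclideanSpace ℝ ι)) :
    (stdGaussianFamily ι).map (fun x => WithLp.ofLp (∑ i, x i • b i)) = stdGaussianFamily ι := by
  have h := (stdGaussian_eq_map_pi_orthonormalBasis b).symm.trans
    (map_pi_eq_stdGaussian (ι := ι)).symm
  have h2 := congrArg (Measure.map (WithLp.ofLp (p := 2) (V := ι → ℝ))) h
  rw [Measure.map_map (by fun_prop) (by fun_prop),
    Measure.map_map (by fun_prop) (by fun_prop)] at h2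
  have e : (WithLp.ofLp (p := 2) (V := ι → ℝ)) ∘ WithLp.toLp 2 = id := by ext; rfl
  rw [e, Measure.map_id] at h2
  exact h2

theorem dotProduct_eq_inner {ι : Type} [Fintype ι] (x y : EuclideanSpace ℝ ι) :
    WithLp.ofLp x ⬝ᵥ WithLp.ofLp y = inner ℝ x y := by
  rw [EuclideanSpace.inner_eq_star_dotProduct, dotProduct_comm]; simp

section QuadraticForm

variable {ι : Type} [Fintype ι] [DecidableEq ι] {A : Matrix ι ι ℝ}

theorem mulVec_sum_eigenvectorBasis (hA : A.IsHermitian) (x : ι → ℝ) :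
    A *ᵥ WithLp.ofLp (∑ i, x i • hA.eigenvectorBasis i) =
      WithLp.ofLp (∑ i, (hA.eigenvalues i * x i) • hA.eigenvectorBasis i) := by
  simp only [WithLp.ofLp_sum, WithLp.ofLp_smul, Matrix.mulVec_sum, Matrix.mulVec_smul,
    hA.mulVec_eigenvectorBasis, smul_smul]
  refine Finset.sum_congr rfl fun i _ => ?_
  rw [mul_comm]

theorem quadratic_sum_eigenvectorBasis (hA : A.IsHermitian) (x : ι → ℝ) :
    WithLp.ofLp (∑ i, x i • hA.eigenvectorBasis i) ⬝ᵥ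
      (A *ᵥ WithLp.ofLp (∑ i, x i • hA.eigenvectorBasis i)) =
      ∑ i, hA.eigenvalues i * x i ^ 2 := by
  rw [mulVec_sum_eigenvectorBasis, dotProduct_eq_inner, sum_inner]
  refine Finset.sum_congr rfl fun i _ => ?_
  rw [inner_smul_left, hA.eigenvectorBasis.orthonormal.inner_right_fintype]
  simp; ring

theorem abs_eigenvalues_le (hA : A.IsHermitian) {K : ℝ}
    (hK : ∀ x : ι → ℝ, |x ⬝ᵥ (A *ᵥ x)| ≤ K * (x ⬝ᵥ x)) (i : ι) : |hA.eigenvalues i| ≤ K := by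
  have h := hK (WithLp.ofLp (hA.eigenvectorBasis i))
  rw [hA.mulVec_eigenvectorBasis, dotProduct_smul, dotProduct_eq_inner,
    real_inner_self_eq_norm_sq, hA.eigenvectorBasis.norm_eq_one] at h
  simpa using h

/-- Each `λᵢ²` is `‖A bᵢ‖²`; expand it along the rows of `A` and apply Parseval to each row. -/
theorem sum_sq_eigenvalues (hA : A.IsHermitian) :
    ∑ i, hA.eigenvalues i ^ 2 = ∑ i, ∑ j, A i j ^ 2 := by
  have h1 : ∀ i, hA.eigenvalues i ^ 2 =
      ∑ j, inner ℝ (WithLp.toLp 2 (A j)) (hA.eigenvectorBasis i) ^ 2 := by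
    intro i
    have h := congrArg (fun v : ι → ℝ => v ⬝ᵥ v) (hA.mulVec_eigenvectorBasis i)
    simp only [smul_dotProduct, dotProduct_smul] at h
    rw [dotProduct_eq_inner (hA.eigenvectorBasis i), real_inner_self_eq_norm_sq,
      hA.eigenvectorBasis.norm_eq_one] at h
    simp only [smul_eq_mul, one_pow, mul_one] at h
    rw [sq, ← h, dotProduct]
    refine Finset.sum_congr rfl fun j _ => ?_
    rw [← dotProduct_eq_inner, sq]
    rfl
  simp_rw [h1]
  rw [Finset.sum_comm]
  refine Finset.sum_congr rfl fun j _ => ?_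
  rw [hA.eigenvectorBasis.sum_sq_inner_left, EuclideanSpace.real_norm_sq_eq]

theorem trace_eq_sum_real_eigenvalues (hA : A.IsHermitian) :
    A.trace = ∑ i, hA.eigenvalues i := by
  simpa using hA.trace_eq_sum_eigenvalues

/-- Moment generating function bound for a Gaussian quadratic form. -/
theorem integral_exp_quadratic (hA : A.IsHermitian) {K t : ℝ} (ht : 0 ≤ t) (htK : t * K ≤ 1 / 4)
    (hK : ∀ x : ι → ℝ, |x ⬝ᵥ (A *ᵥ x)| ≤ K * (x ⬝ᵥ x)) :
    Integrable (fun x => Real.exp (t * (x ⬝ᵥ (A *ᵥ x)))) (stdGaussianFamily ι) ∧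
    ∫ x, Real.exp (t * (x ⬝ᵥ (A *ᵥ x))) ∂(stdGaussianFamily ι) ≤
      Real.exp (t * A.trace + 2 * t ^ 2 * ∑ i, ∑ j, A i j ^ 2) := by
  set b := hA.eigenvectorBasis
  set μ := hA.eigenvalues
  have hμ : ∀ i, |t * μ i| ≤ 1 / 4 := fun i => by
    rw [abs_mul, abs_of_nonneg ht]
    exact (mul_le_mul_of_nonneg_left (abs_eigenvalues_le hA hK i) ht).trans htK
  have hm : Measurable (fun x : ι → ℝ => WithLp.ofLp (∑ i, x i • b i)) := by fun_prop
  have hc : Continuous fun x : ι → ℝ => Real.exp (t * (x ⬝ᵥ (A *ᵥ x))) := by fun_prop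
  -- In the eigenbasis the exponential factorises, so rotation invariance reduces everything to
  -- one-dimensional integrals.
  have hcomp : ∀ x : ι → ℝ, Real.exp (t * (WithLp.ofLp (∑ i, x i • b i) ⬝ᵥ
      (A *ᵥ WithLp.ofLp (∑ i, x i • b i)))) = ∏ i, Real.exp (t * μ i * x i ^ 2) := by
    intro x
    rw [quadratic_sum_eigenvectorBasis, Finset.mul_sum, Real.exp_sum]
    simp_rw [mul_assoc]; rfl
  constructor
  · rw [← map_stdGaussianFamily_orthonormalBasis b,
      integrable_map_measure hc.aestronglyMeasurable hm.aemeasurable]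
    simp only [Function.comp_def, hcomp]
    exact Integrable.fintype_prod fun i => integrable_exp_mul_sq (abs_le.1 (hμ i)).2
  · rw [← map_stdGaussianFamily_orthonormalBasis b,
      integral_map hm.aemeasurable hc.aestronglyMeasurable]
    simp only [hcomp]
    rw [stdGaussianFamily,
      integral_fintype_prod_eq_prod (f := fun i (x : ℝ) => Real.exp (t * μ i * x ^ 2)),
      trace_eq_sum_real_eigenvalues hA, ← sum_sq_eigenvalues hA, Finset.mul_sum, Finset.mul_sum,
      ← Finset.sum_add_distrib, Real.exp_sum]
    refine Finset.prod_le_prod (fun i _ => integral_nonneg fun x => (Real.exp_pos _).le)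
      fun i _ => ?_
    refine (integral_exp_mul_sq_le (abs_le.1 (hμ i)).2).trans (le_of_eq ?_)
    congr 1
    ring

/-- Tail bound for a Gaussian quadratic form. -/
theorem measureReal_le_quadratic (hA : A.IsHermitian) {K t : ℝ} (ht : 0 ≤ t)
    (htK : t * K ≤ 1 / 4) (hK : ∀ x : ι → ℝ, |x ⬝ᵥ (A *ᵥ x)| ≤ K * (x ⬝ᵥ x)) (s : ℝ) :
    (stdGaussianFamily ι).real {x | s ≤ x ⬝ᵥ (A *ᵥ x)} ≤
      Real.exp (-t * s + t * A.trace + 2 * t ^ 2 * ∑ i, ∑ j, A i j ^ 2) := by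
  obtain ⟨hi, hb⟩ := integral_exp_quadratic hA ht htK hK
  refine (measure_ge_le_exp_mul_mgf s ht hi).trans ?_
  rw [add_assoc, Real.exp_add]
  exact mul_le_mul_of_nonneg_left hb (Real.exp_pos _).le

end QuadraticForm

/-- Tail bound for a Gaussian linear form. -/
theorem measureReal_le_linear {ι : Type} [Fintype ι] (v : ι → ℝ) {t : ℝ} (ht : 0 ≤ t) (s : ℝ) :
    (stdGaussianFamily ι).real {x | s ≤ v ⬝ᵥ x} ≤
      Real.exp (-t * s + t ^ 2 / 2 * ∑ i, v i ^ 2) := by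
  have e : ∀ x : ι → ℝ, Real.exp (t * (v ⬝ᵥ x)) = ∏ i, Real.exp ((t * v i) * x i) := by
    intro x
    rw [dotProduct, Finset.mul_sum, Real.exp_sum]
    simp_rw [mul_assoc]
  have hi : Integrable (fun x => Real.exp (t * (v ⬝ᵥ x))) (stdGaussianFamily ι) := by
    simp only [e]
    exact Integrable.fintype_prod (f := fun i (x : ℝ) => Real.exp ((t * v i) * x))
      fun i => integrable_exp_mul_gaussianReal _
  refine (measure_ge_le_exp_mul_mgf s ht hi).trans (le_of_eq ?_)
  rw [Real.exp_add]
  congr 1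
  rw [mgf]
  simp only [e]
  rw [stdGaussianFamily,
    integral_fintype_prod_eq_prod (f := fun i (x : ℝ) => Real.exp ((t * v i) * x)), Finset.mul_sum,
    Real.exp_sum]
  refine Finset.prod_congr rfl fun i _ => ?_
  have := congrFun (mgf_fun_id_gaussianReal (μ := 0) (v := 1)) (t * v i)
  rw [mgf] at this
  rw [this]
  congr 1
  simp; ring

/-! ### Permutations of nodes and the edges they move. -/

variable {n p : ℕ}

theorem edgeMap_one (e : Edge n) : edgeMap 1 e = e := by
  apply Subtype.ext
  simp [edgeMap]

theorem edgeMap_mul (σ τ : Equiv.Perm (Fin n)) (e : Edge n) :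
    edgeMap (σ * τ) e = edgeMap σ (edgeMap τ e) := by
  apply Subtype.ext
  simp [edgeMap, Sym2.map_map]

theorem edgeMap_inv_apply_self (σ : Equiv.Perm (Fin n)) (e : Edge n) :
    edgeMap σ⁻¹ (edgeMap σ e) = e := by
  rw [← edgeMap_mul, inv_mul_cancel, edgeMap_one]

theorem edgeMap_apply_inv_self (σ : Equiv.Perm (Fin n)) (e : Edge n) :
    edgeMap σ (edgeMap σ⁻¹ e) = e := by
  rw [← edgeMap_mul, mul_inv_cancel, edgeMap_one]

/-- The permutation of the edges induced by a permutation of the nodes. -/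
def edgePerm (σ : Equiv.Perm (Fin n)) : Equiv.Perm (Edge n) where
  toFun := edgeMap σ
  invFun := edgeMap σ⁻¹
  left_inv := edgeMap_inv_apply_self σ
  right_inv := edgeMap_apply_inv_self σ

theorem sum_edgeMap (σ : Equiv.Perm (Fin n)) (f : Edge n → ℝ) :
    ∑ e, f (edgeMap σ e) = ∑ e, f e :=
  Equiv.sum_comp (edgePerm σ) f

/-- The number of edges moved by a permutation of the nodes. -/
def movedEdges (σ : Equiv.Perm (Fin n)) : ℕ :=
  (Finset.univ.filter fun e : Edge n => edgeMap σ e ≠ e).card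

/-- The number of nodes moved by a permutation. -/
def movedNodes (σ : Equiv.Perm (Fin n)) : ℕ := (Finset.univ.filter fun u => σ u ≠ u).card

theorem movedEdges_eq_sum (σ : Equiv.Perm (Fin n)) :
    (movedEdges σ : ℝ) = ∑ e : Edge n, if edgeMap σ e ≠ e then (1 : ℝ) else 0 := by
  rw [movedEdges, Finset.card_filter]
  push_cast
  rfl

/-- If `σ` moves `u`, it can fix the edge `{u, v}` only when `v = σ u`. Each moved node thus lies on
at least `n - 2` moved edges, and an edge is counted at most twice. -/
theorem movedNodes_mul_le (σ : Equiv.Perm (Fin n)) :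
    movedNodes σ * (n - 2) ≤ 2 * movedEdges σ := by
  classical
  set s : Finset (Fin n × Fin n) :=
    (Finset.univ.filter fun u => σ u ≠ u).biUnion fun u =>
      (({u, σ u} : Finset (Fin n))ᶜ).map ⟨fun v => (u, v), fun _ _ h => (Prod.mk.inj h).2⟩ with hs
  have hmem : ∀ a ∈ s, σ a.1 ≠ a.1 ∧ a.2 ≠ a.1 ∧ a.2 ≠ σ a.1 := by
    rintro ⟨u, v⟩ h
    simp only [hs, Finset.mem_biUnion, Finset.mem_filter, Finset.mem_univ, true_and,
      Finset.mem_map, Finset.mem_compl, Finset.mem_insert, Finset.mem_singleton] at h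
    obtain ⟨u', hu, v', hv, rfl, rfl⟩ := h
    push Not at hv
    exact ⟨hu, hv.1, hv.2⟩
  have hcard : s.card = movedNodes σ * (n - 2) := by
    rw [hs, Finset.card_biUnion]
    · rw [Finset.sum_congr rfl (g := fun _ => n - 2), Finset.sum_const, smul_eq_mul]
      · rfl
      · intro u hu
        rw [Finset.card_map, Finset.card_compl, Finset.card_pair, Fintype.card_fin]
        exact (Finset.mem_filter.1 hu).2.symm
    · intro u _ v _ huv
      rw [Function.onFun, Finset.disjoint_left]
      rintro ⟨a, b⟩ h1 h2
      simp only [Finset.mem_map] at h1 h2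
      obtain ⟨_, _, rfl, _⟩ := h1
      obtain ⟨_, _, rfl, _⟩ := h2
      exact huv rfl
  rw [← hcard, movedEdges, ← Finset.card_map (Function.Embedding.subtype _)]
  refine Finset.card_le_mul_card_image_of_maps_to (f := fun a => s(a.1, a.2)) ?_ 2 ?_
  · rintro ⟨u, v⟩ h
    obtain ⟨h1, h2, h3⟩ := hmem _ h
    simp only at h1 h2 h3
    simp only [Finset.mem_map, Finset.mem_filter, Finset.mem_univ, true_and,
      Function.Embedding.coe_subtype]
    refine ⟨⟨s(u, v), by simpa using h2.symm⟩, ?_, rfl⟩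
    intro h
    have h := congrArg Subtype.val h
    simp only [edgeMap, Sym2.map_mk, Sym2.eq_iff] at h
    rcases h with ⟨h, _⟩ | ⟨h, _⟩
    · exact h1 h
    · exact h3 h.symm
  · intro b _
    induction b using Sym2.ind with
    | _ x y =>
      refine (Finset.card_le_card (t := {(x, y), (y, x)}) ?_).trans Finset.card_le_two
      rintro ⟨u, v⟩ h
      have h := (Finset.mem_filter.1 h).2
      simp only [Sym2.eq_iff] at h
      simpa using h

theorem mul_movedNodes_le (hn : 4 ≤ n) (σ : Equiv.Perm (Fin n)) :
    n * movedNodes σ ≤ 4 * movedEdges σ := by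
  have h := movedNodes_mul_le σ
  have h2 : n ≤ 2 * (n - 2) := by omega
  nlinarith [Nat.mul_le_mul_left (movedNodes σ) h2]

/-! ### The objective as a quadratic form. -/

/-- The matrix `Π (J_p ⊗ I_N) Πᵀ`. -/
noncomputable def agreement (π : PermTuple n p) : Matrix (Fin p × Edge n) (Fin p × Edge n) ℝ :=
  Matrix.of fun a b => if edgeMap (π a.1) a.2 = edgeMap (π b.1) b.2 then 1 else 0

theorem blockPerm_mul_onesMatrix_mul (π : PermTuple n p) :
    blockPerm π * (onesMatrix p ⊗ₖ (1 : Matrix (Edge n) (Edge n) ℝ)) * (blockPerm π)ᵀ =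
      agreement π := by
  have h : ∀ (M : Matrix (Fin p × Edge n) (Fin p × Edge n) ℝ) a b,
      (blockPerm π * M) a b = M (a.1, edgeMap (π a.1) a.2) b := by
    intro M a b
    rw [Matrix.mul_apply, Finset.sum_eq_single (a.1, edgeMap (π a.1) a.2)]
    · simp [blockPerm]
    · rintro ⟨k, f⟩ - hne
      have : ¬ (a.1 = k ∧ edgeMap (π a.1) a.2 = f) := by
        rintro ⟨rfl, rfl⟩; exact hne rfl
      simp [blockPerm, this]
    · simp
  ext a b
  rw [Matrix.mul_assoc, h, ← Matrix.transpose_apply (_ * _), Matrix.transpose_mul,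
    Matrix.transpose_transpose, h]
  simp [onesMatrix, agreement, Matrix.one_apply]

theorem mleObjective_eq (G : Weights n p) (π : PermTuple n p) :
    mleObjective G π = G ⬝ᵥ (agreement π *ᵥ G) := by
  rw [mleObjective, blockPerm_mul_onesMatrix_mul]

theorem edgeMap_eq_edgeMap_iff (σ τ : Equiv.Perm (Fin n)) (e f : Edge n) :
    edgeMap σ e = edgeMap τ f ↔ edgeMap (τ⁻¹ * σ) e = f := by
  rw [edgeMap_mul]
  constructor
  · intro h; rw [h, edgeMap_inv_apply_self]
  · rintro rfl; rw [edgeMap_apply_inv_self]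

theorem agreement_mulVec (π : PermTuple n p) (x : Weights n p) (j : Fin p) (e : Edge n) :
    (agreement π *ᵥ x) (j, e) = ∑ k, x (k, edgeMap ((π k)⁻¹ * π j) e) := by
  rw [Matrix.mulVec, dotProduct, Fintype.sum_prod_type]
  refine Finset.sum_congr rfl fun k _ => ?_
  simp [agreement, edgeMap_eq_edgeMap_iff]

/-- Grouping the entries by their common label `f` exhibits a sum of squares, which gives positivity
and, by Cauchy–Schwarz, the operator bound `p`. -/
theorem agreement_quadratic (π : PermTuple n p) (x : Weights n p) :
    x ⬝ᵥ (agreement π *ᵥ x) = ∑ f, (∑ j, x (j, edgeMap (π j)⁻¹ f)) ^ 2 := by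
  rw [dotProduct, Fintype.sum_prod_type]
  have h : ∀ j, ∑ e, x (j, e) * (agreement π *ᵥ x) (j, e) =
      ∑ f, x (j, edgeMap (π j)⁻¹ f) * ∑ k, x (k, edgeMap (π k)⁻¹ f) := by
    intro j
    rw [← sum_edgeMap (π j) fun f => x (j, edgeMap (π j)⁻¹ f) * ∑ k, x (k, edgeMap (π k)⁻¹ f)]
    refine Finset.sum_congr rfl fun e _ => ?_
    rw [agreement_mulVec, edgeMap_inv_apply_self]
    simp only [edgeMap_mul]
  simp_rw [h]
  rw [Finset.sum_comm]
  refine Finset.sum_congr rfl fun f _ => ?_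
  rw [← Finset.sum_mul, sq]

theorem agreement_quadratic_nonneg (π : PermTuple n p) (x : Weights n p) :
    0 ≤ x ⬝ᵥ (agreement π *ᵥ x) := by
  rw [agreement_quadratic]
  positivity

theorem agreement_quadratic_le (π : PermTuple n p) (x : Weights n p) :
    x ⬝ᵥ (agreement π *ᵥ x) ≤ p * (x ⬝ᵥ x) := by
  rw [agreement_quadratic, dotProduct, Fintype.sum_prod_type]
  have h : ∀ j, ∑ e, x (j, e) * x (j, e) = ∑ f, x (j, edgeMap (π j)⁻¹ f) ^ 2 := by
    intro j
    rw [← sum_edgeMap (π j)⁻¹]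
    simp only [sq]
  simp_rw [h]
  rw [Finset.sum_comm, Finset.mul_sum]
  refine Finset.sum_le_sum fun f _ => ?_
  simpa using sq_sum_le_card_mul_sum_sq (s := Finset.univ)
    (f := fun j : Fin p => x (j, edgeMap (π j)⁻¹ f))

theorem mleObjective_relabel (G : Weights n p) (π : PermTuple n p) (ψ : Equiv.Perm (Fin n)) :
    mleObjective G (fun j => ψ * π j) = mleObjective G π := by
  have : agreement (fun j => ψ * π j) = agreement π := by
    ext a b
    simp only [agreement, Matrix.of_apply, edgeMap_mul, (edgeMap_injective ψ).eq_iff]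
  rw [mleObjective_eq, mleObjective_eq, this]

/-! ### Trace and norms of the difference of two objectives. -/

/-- The matrix of the quadratic form `mleObjective · π - mleObjective · π'`. -/
noncomputable def discrepancy (π π' : PermTuple n p) : Matrix (Fin p × Edge n) (Fin p × Edge n) ℝ :=
  agreement π - agreement π'

theorem isHermitian_agreement (π : PermTuple n p) : (agreement π).IsHermitian := by
  ext a b
  simp [agreement, eq_comm]

theorem isHermitian_discrepancy (π π' : PermTuple n p) : (discrepancy π π').IsHermitian :=
  (isHermitian_agreement π).sub (isHermitian_agreement π')

theorem trace_discrepancy (π π' : PermTuple n p) : (discrepancy π π').trace = 0 := by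
  simp [discrepancy, agreement, Matrix.trace]

theorem discrepancy_quadratic (π π' : PermTuple n p) (G : Weights n p) :
    G ⬝ᵥ (discrepancy π π' *ᵥ G) = mleObjective G π - mleObjective G π' := by
  rw [discrepancy, Matrix.sub_mulVec, dotProduct_sub, mleObjective_eq, mleObjective_eq]

/-- Both forms take values in `[0, p‖G‖²]`, so their difference costs `p` and not `2p`. -/
theorem abs_discrepancy_quadratic_le (π π' : PermTuple n p) (G : Weights n p) :
    |G ⬝ᵥ (discrepancy π π' *ᵥ G)| ≤ p * (G ⬝ᵥ G) := by
  rw [discrepancy_quadratic, mleObjective_eq, mleObjective_eq]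
  have h1 := agreement_quadratic_nonneg π G
  have h2 := agreement_quadratic_nonneg π' G
  have h3 := agreement_quadratic_le π G
  have h4 := agreement_quadratic_le π' G
  rw [abs_le]
  constructor <;> linarith

/-- The node permutation comparing the relative alignments of the graphs `j` and `k`
prescribed by `π` and `π'`. -/
def relPerm (π π' : PermTuple n p) (j k : Fin p) : Equiv.Perm (Fin n) :=
  π' k * (π k)⁻¹ * π j * (π' j)⁻¹

/-- The total number of edges on which the relative alignments of `π` and `π'` differ. -/
noncomputable def totalMoved (π π' : PermTuple n p) : ℝ :=
  ∑ j, ∑ k, (movedEdges (relPerm π π' j k) : ℝ)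

theorem relPerm_edgeMap (π π' : PermTuple n p) (j k : Fin p) (e : Edge n) :
    edgeMap (relPerm π π' j k) (edgeMap (π' j) e) = edgeMap (π' k) (edgeMap ((π k)⁻¹ * π j) e) := by
  rw [← edgeMap_mul, ← edgeMap_mul, relPerm]
  congr 1
  group

theorem sum_sub_indicator_sq {ι : Type*} [Fintype ι] [DecidableEq ι] (a b : ι) :
    ∑ i, ((if a = i then (1 : ℝ) else 0) - if b = i then 1 else 0) ^ 2 =
      2 * if a ≠ b then 1 else 0 := by
  have : ∀ i, ((if a = i then (1 : ℝ) else 0) - if b = i then 1 else 0) ^ 2 =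
      (if a = i then (1 : ℝ) else 0) + (if b = i then 1 else 0) -
        2 * if a = i then (if b = i then 1 else 0) else 0 := by
    intro i
    split_ifs <;> norm_num
  simp_rw [this]
  rw [Finset.sum_sub_distrib, Finset.sum_add_distrib, ← Finset.mul_sum]
  by_cases h : a = b
  · subst h; simp; norm_num
  · have h' : ¬ b = a := fun h2 => h h2.symm
    simp [h, h']; norm_num

/-- In row `(j, e)`, each agreement matrix has exactly one nonzero entry in block `k`. The
difference contributes `2` when the two positions differ, that is, when `relPerm π π' j k` moves
`edgeMap (π' j) e`, and `0` otherwise. -/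
theorem sum_sq_discrepancy (π π' : PermTuple n p) :
    ∑ a, ∑ b, discrepancy π π' a b ^ 2 = 2 * totalMoved π π' := by
  simp only [Fintype.sum_prod_type, totalMoved, Finset.mul_sum]
  refine Finset.sum_congr rfl fun j _ => ?_
  rw [Finset.sum_comm]
  refine Finset.sum_congr rfl fun k _ => ?_
  rw [movedEdges_eq_sum,
    ← sum_edgeMap (π' j) fun e => if edgeMap (relPerm π π' j k) e ≠ e then (1 : ℝ) else 0,
    Finset.mul_sum]
  refine Finset.sum_congr rfl fun e _ => ?_
  simp only [discrepancy, Matrix.sub_apply, agreement, Matrix.of_apply, edgeMap_eq_edgeMap_iff]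
  rw [sum_sub_indicator_sq, relPerm_edgeMap]
  congr 1
  refine if_congr (not_congr ?_) rfl rfl
  rw [edgeMap_mul (π' k)⁻¹ (π' j)]
  constructor
  · intro h; rw [h, edgeMap_apply_inv_self]
  · intro h; rw [← h, edgeMap_inv_apply_self]

/-! ### Drift, linear and quadratic parts of the objective gap. -/

/-- The energy `‖H - H ∘ σ‖²`. -/
noncomputable def energy (H : Edge n → ℝ) (σ : Equiv.Perm (Fin n)) : ℝ :=
  ∑ e, (H e - H (edgeMap σ e)) ^ 2

/-- The total energy of the misaligned signal. -/
noncomputable def totalEnergy (H : Edge n → ℝ) (π π' : PermTuple n p) : ℝ :=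
  ∑ j, ∑ k, energy H (relPerm π π' j k)

/-- The signal seen through the alignment `π`. -/
def signal (H : Edge n → ℝ) (π : PermTuple n p) : Weights n p := fun a => H (edgeMap (π a.1) a.2)

theorem discrepancy_mulVec_signal (H : Edge n → ℝ) (π π' : PermTuple n p) (j : Fin p)
    (e : Edge n) : (discrepancy π π' *ᵥ signal H π') (j, e) =
      -∑ k, (H (edgeMap (π' j) e) - H (edgeMap (relPerm π π' j k) (edgeMap (π' j) e))) := by
  rw [discrepancy, Matrix.sub_mulVec, Pi.sub_apply, agreement_mulVec, agreement_mulVec,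
    ← Finset.sum_sub_distrib, ← Finset.sum_neg_distrib]
  refine Finset.sum_congr rfl fun k _ => ?_
  rw [relPerm_edgeMap]
  simp only [signal]
  rw [edgeMap_mul (π' k)⁻¹, edgeMap_apply_inv_self]
  ring

/-- Since `H ↦ H ∘ σ` is an isometry, `⟨H, H - H ∘ σ⟩ = ‖H - H ∘ σ‖² / 2` for each pair of graphs.
-/
theorem signal_quadratic (H : Edge n → ℝ) (π π' : PermTuple n p) :
    signal H π' ⬝ᵥ (discrepancy π π' *ᵥ signal H π') = -(1 / 2) * totalEnergy H π π' := by
  rw [dotProduct, Fintype.sum_prod_type, totalEnergy, Finset.mul_sum]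
  refine Finset.sum_congr rfl fun j _ => ?_
  simp only [discrepancy_mulVec_signal]
  simp only [signal]
  rw [sum_edgeMap (π' j) fun g => H g * -∑ k, (H g - H (edgeMap (relPerm π π' j k) g))]
  simp only [mul_neg, Finset.mul_sum, ← Finset.sum_neg_distrib]
  rw [Finset.sum_comm]
  refine Finset.sum_congr rfl fun k _ => ?_
  have h := sum_edgeMap (relPerm π π' j k) fun g => H g ^ 2
  have h2 : energy H (relPerm π π' j k) = ∑ g, H g ^ 2 +
      ∑ g, H (edgeMap (relPerm π π' j k) g) ^ 2 -
        2 * ∑ g, H g * H (edgeMap (relPerm π π' j k) g) := by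
    rw [energy, Finset.mul_sum, ← Finset.sum_add_distrib, ← Finset.sum_sub_distrib]
    refine Finset.sum_congr rfl fun g _ => ?_
    ring
  rw [h2, h]
  simp only [mul_sub, Finset.sum_sub_distrib, Finset.sum_neg_distrib]
  simp only [← sq]
  ring

/-- Cauchy–Schwarz over `k`. The variance of the linear term is thereby controlled by the same
energy that drives the drift, so no upper bound on the energy is needed. -/
theorem sum_sq_discrepancy_mulVec_signal_le (H : Edge n → ℝ) (π π' : PermTuple n p) :
    ∑ a, (discrepancy π π' *ᵥ signal H π') a ^ 2 ≤ p * totalEnergy H π π' := by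
  rw [Fintype.sum_prod_type, totalEnergy, Finset.mul_sum]
  refine Finset.sum_le_sum fun j _ => ?_
  simp only [discrepancy_mulVec_signal]
  rw [sum_edgeMap (π' j) fun g => (-∑ k, (H g - H (edgeMap (relPerm π π' j k) g))) ^ 2]
  simp only [energy]
  rw [Finset.sum_comm, Finset.mul_sum]
  refine Finset.sum_le_sum fun g _ => ?_
  rw [neg_sq]
  simpa using sq_sum_le_card_mul_sum_sq (s := Finset.univ)
    (f := fun k : Fin p => H g - H (edgeMap (relPerm π π' j k) g))

theorem observation_eq (ρ : ℝ) (π : PermTuple n p) (H : Edge n → ℝ) (Z : Weights n p) :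
    observation ρ π H Z = √ρ • signal H π + √(1 - ρ) • Z := by
  ext a; simp [observation, signal]

theorem mleObjective_sub_mleObjective {ρ : ℝ} (h0 : 0 ≤ ρ) (h1 : ρ ≤ 1) (π π' : PermTuple n p)
    (H : Edge n → ℝ) (Z : Weights n p) :
    mleObjective (observation ρ π' H Z) π - mleObjective (observation ρ π' H Z) π' =
      -(1 / 2) * (ρ * totalEnergy H π π') +
        ((2 * √ρ * √(1 - ρ)) • (discrepancy π π' *ᵥ signal H π')) ⬝ᵥ Z +
        Z ⬝ᵥ (((1 - ρ) • discrepancy π π') *ᵥ Z) := by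
  have hs : signal H π' ⬝ᵥ (discrepancy π π' *ᵥ Z) =
      (discrepancy π π' *ᵥ signal H π') ⬝ᵥ Z := by
    rw [Matrix.dotProduct_mulVec, ← Matrix.mulVec_transpose]
    congr 2
    simpa using (isHermitian_discrepancy π π').eq
  rw [← discrepancy_quadratic, observation_eq, Matrix.mulVec_add, Matrix.mulVec_smul,
    Matrix.mulVec_smul, add_dotProduct, dotProduct_add, dotProduct_add]
  simp only [smul_dotProduct, dotProduct_smul, smul_eq_mul, signal_quadratic, hs,
    Matrix.smul_mulVec]
  rw [dotProduct_comm Z (discrepancy π π' *ᵥ signal H π')]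
  have e1 := Real.mul_self_sqrt h0
  have e2 := Real.mul_self_sqrt (sub_nonneg.2 h1)
  linear_combination (-(1 / 2) * totalEnergy H π π') * e1 +
    (Z ⬝ᵥ (discrepancy π π' *ᵥ Z)) * e2

/-! ### Uniform lower bound on the energy of misaligned signals. -/

/-- The matrix of the quadratic form `energy · σ`. -/
noncomputable def energyMatrix (σ : Equiv.Perm (Fin n)) : Matrix (Edge n) (Edge n) ℝ :=
  Matrix.of fun e f => ((if e = f then 1 else 0) - if edgeMap σ e = f then 1 else 0) +
    ((if e = f then 1 else 0) - if edgeMap σ⁻¹ e = f then 1 else 0)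

theorem energyMatrix_quadratic (σ : Equiv.Perm (Fin n)) (H : Edge n → ℝ) :
    H ⬝ᵥ (energyMatrix σ *ᵥ H) = energy H σ := by
  have h1 : ∀ e, (energyMatrix σ *ᵥ H) e =
      (H e - H (edgeMap σ e)) + (H e - H (edgeMap σ⁻¹ e)) := by
    intro e
    simp [energyMatrix, Matrix.mulVec, dotProduct, add_mul, sub_mul, Finset.sum_add_distrib,
      Finset.sum_sub_distrib]
  have h2 := sum_edgeMap σ fun e => H e * (H e - H (edgeMap σ⁻¹ e))
  simp only [edgeMap_inv_apply_self] at h2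
  simp only [dotProduct, h1, mul_add, Finset.sum_add_distrib]
  rw [← h2, ← Finset.sum_add_distrib, energy]
  refine Finset.sum_congr rfl fun e _ => ?_
  ring

theorem energy_nonneg (H : Edge n → ℝ) (σ : Equiv.Perm (Fin n)) : 0 ≤ energy H σ :=
  Finset.sum_nonneg fun _ _ => sq_nonneg _

theorem energy_le (H : Edge n → ℝ) (σ : Equiv.Perm (Fin n)) : energy H σ ≤ 4 * (H ⬝ᵥ H) := by
  have h := sum_edgeMap σ fun e => H e ^ 2
  calc energy H σ ≤ ∑ e, (2 * H e ^ 2 + 2 * H (edgeMap σ e) ^ 2) :=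
        Finset.sum_le_sum fun e _ => by nlinarith [sq_nonneg (H e + H (edgeMap σ e))]
    _ = 4 * (H ⬝ᵥ H) := by
      rw [Finset.sum_add_distrib, ← Finset.mul_sum, ← Finset.mul_sum, h, dotProduct]
      simp only [← sq]
      ring

theorem isHermitian_energyMatrix (σ : Equiv.Perm (Fin n)) : (energyMatrix σ).IsHermitian := by
  have h : ∀ (σ : Equiv.Perm (Fin n)) (e f : Edge n), edgeMap σ e = f ↔ edgeMap σ⁻¹ f = e := by
    intro σ e f
    constructor
    · rintro rfl; exact edgeMap_inv_apply_self σ e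
    · rintro rfl; exact edgeMap_apply_inv_self σ f
  ext e f
  have h1 := h σ e f
  have h2 := h σ f e
  simp only [energyMatrix, Matrix.conjTranspose_apply, Matrix.of_apply, star_trivial, h1, h2,
    eq_comm (a := f) (b := e)]
  ring

theorem movedEdges_eq_sum_inv (σ : Equiv.Perm (Fin n)) :
    (movedEdges σ : ℝ) = ∑ e : Edge n, if e ≠ edgeMap σ⁻¹ e then (1 : ℝ) else 0 := by
  rw [movedEdges_eq_sum, ← sum_edgeMap σ fun e => if e ≠ edgeMap σ⁻¹ e then (1 : ℝ) else 0]
  simp only [edgeMap_inv_apply_self]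

theorem trace_energyMatrix (σ : Equiv.Perm (Fin n)) :
    (energyMatrix σ).trace = 2 * movedEdges σ := by
  rw [two_mul]
  nth_rw 2 [movedEdges_eq_sum_inv]
  rw [movedEdges_eq_sum, ← Finset.sum_add_distrib, Matrix.trace]
  refine Finset.sum_congr rfl fun e _ => ?_
  simp only [Matrix.diag_apply, energyMatrix, Matrix.of_apply, if_true, ne_eq,
    eq_comm (a := e) (b := edgeMap σ⁻¹ e)]
  split_ifs <;> norm_num

theorem sum_sq_energyMatrix_le (σ : Equiv.Perm (Fin n)) :
    ∑ e, ∑ f, energyMatrix σ e f ^ 2 ≤ 8 * movedEdges σ := by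
  have e8 : (8 : ℝ) * movedEdges σ = 4 * movedEdges σ + 4 * movedEdges σ := by ring
  rw [e8]
  nth_rw 2 [movedEdges_eq_sum_inv]
  rw [movedEdges_eq_sum, Finset.mul_sum, Finset.mul_sum, ← Finset.sum_add_distrib]
  refine Finset.sum_le_sum fun e _ => ?_
  have h1 := sum_sub_indicator_sq e (edgeMap σ e)
  have h2 := sum_sub_indicator_sq e (edgeMap σ⁻¹ e)
  simp only [ne_comm (a := e) (b := edgeMap σ e)] at h1
  calc ∑ f, energyMatrix σ e f ^ 2
      ≤ ∑ f, (2 * ((if e = f then (1 : ℝ) else 0) - if edgeMap σ e = f then 1 else 0) ^ 2 +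
          2 * ((if e = f then (1 : ℝ) else 0) - if edgeMap σ⁻¹ e = f then 1 else 0) ^ 2) :=
        Finset.sum_le_sum fun f _ => by
          rw [energyMatrix, Matrix.of_apply, ← mul_add]
          exact add_sq_le
    _ = _ := by
      rw [Finset.sum_add_distrib, ← Finset.mul_sum, ← Finset.mul_sum, h1, h2]
      ring

/-- The mean energy is twice the number `m` of moved edges. With `K = 4`, the value `t = 1/16`
saturates `t * K ≤ 1/4`, and the exponent is `m/32 - m/8 + m/16`. -/
theorem measureReal_energy_le (σ : Equiv.Perm (Fin n)) :
    (stdGaussianFamily (Edge n)).real {H | energy H σ ≤ movedEdges σ / 2} ≤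
      Real.exp (-(movedEdges σ / 32)) := by
  have hq : ∀ H : Edge n → ℝ, H ⬝ᵥ (-energyMatrix σ *ᵥ H) = -energy H σ := fun H => by
    rw [Matrix.neg_mulVec, dotProduct_neg, energyMatrix_quadratic]
  have h := measureReal_le_quadratic (isHermitian_energyMatrix σ).neg (K := 4) (t := 1 / 16)
    (by norm_num) (by norm_num) (fun H => by
      rw [hq, abs_neg, abs_of_nonneg (energy_nonneg H σ)]
      exact energy_le H σ) (-(movedEdges σ / 2))
  simp only [hq, neg_le_neg_iff] at h
  refine h.trans (Real.exp_le_exp.2 ?_)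
  have hs := sum_sq_energyMatrix_le σ
  rw [Matrix.trace_neg, trace_energyMatrix]
  simp only [Matrix.neg_apply, neg_sq]
  linarith

/-- Signals for which every misalignment has a large energy. -/
def goodSignals (n : ℕ) : Set (Edge n → ℝ) :=
  {H | ∀ σ : Equiv.Perm (Fin n), (movedEdges σ : ℝ) / 2 ≤ energy H σ}

theorem measurableSet_goodSignals : MeasurableSet (goodSignals n) := by
  have : goodSignals n = ⋂ σ : Equiv.Perm (Fin n), {H | (movedEdges σ : ℝ) / 2 ≤ energy H σ} := by
    ext; simp [goodSignals]
  rw [this]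
  refine MeasurableSet.iInter fun σ => measurableSet_le measurable_const ?_
  unfold energy
  fun_prop

theorem totalMoved_le_totalEnergy {H : Edge n → ℝ} (hH : H ∈ goodSignals n)
    (π π' : PermTuple n p) : totalMoved π π' / 2 ≤ totalEnergy H π π' := by
  rw [totalMoved, totalEnergy, Finset.sum_div]
  refine Finset.sum_le_sum fun j _ => ?_
  rw [Finset.sum_div]
  exact Finset.sum_le_sum fun k _ => hH _

theorem totalMoved_nonneg (π π' : PermTuple n p) : 0 ≤ totalMoved π π' :=
  Finset.sum_nonneg fun _ _ => Finset.sum_nonneg fun _ _ => Nat.cast_nonneg _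

/-! ### A fixed competitor against the truth. -/

/-- The probability that a given alignment beats the true one, for a good signal. -/
theorem measureReal_mleObjective_le {ρ : ℝ} (h0 : 0 ≤ ρ) (h1 : ρ ≤ 1) (hp : 0 < p)
    {H : Edge n → ℝ} (hH : H ∈ goodSignals n) (π π' : PermTuple n p) {t : ℝ} (ht0 : 0 ≤ t)
    (htρ : t ≤ ρ / 64) (htp : t * p ≤ 1 / 4) :
    (stdGaussianFamily (Fin p × Edge n)).real
      {Z | mleObjective (observation ρ π' H Z) π' ≤ mleObjective (observation ρ π' H Z) π} ≤
      Real.exp (-(ρ * totalMoved π π' / (256 * p))) +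
        Real.exp (-(t * ρ * totalMoved π π' / 16)) := by
  set D := totalEnergy H π π'
  set M := totalMoved π π'
  have hDM : M / 2 ≤ D := totalMoved_le_totalEnergy hH π π'
  have hM : 0 ≤ M := totalMoved_nonneg π π'
  have hp' : (0 : ℝ) < p := by exact_mod_cast hp
  set v := (2 * √ρ * √(1 - ρ)) • (discrepancy π π' *ᵥ signal H π')
  -- To offset the drift `-ρD/2`, one of the two noise terms must reach `ρD/4`.
  have hsub : {Z | mleObjective (observation ρ π' H Z) π' ≤ mleObjective (observation ρ π' H Z) π} ⊆
      {Z | ρ * D / 4 ≤ v ⬝ᵥ Z} ∪ {Z | ρ * D / 4 ≤ Z ⬝ᵥ (((1 - ρ) • discrepancy π π') *ᵥ Z)} := by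
    intro Z hZ
    have h := mleObjective_sub_mleObjective h0 h1 π π' H Z
    simp only [Set.mem_ofPred_eq] at hZ
    by_contra hc
    simp only [Set.mem_union, Set.mem_ofPred_eq, not_or, not_le] at hc
    linarith [hc.1, hc.2]
  refine (measureReal_mono hsub).trans ((measureReal_union_le _ _).trans (add_le_add ?_ ?_))
  -- `t = 1/(16p)` minimises `-tρD/4 + 2t²ρpD`.
  · refine (measureReal_le_linear v (t := 1 / (16 * p)) (by positivity) _).trans
      (Real.exp_le_exp.2 ?_)
    have hv : ∑ a, v a ^ 2 ≤ 4 * ρ * (p * D) := by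
      have e : ∀ a, v a ^ 2 = 4 * ρ * (1 - ρ) * (discrepancy π π' *ᵥ signal H π') a ^ 2 := by
        intro a
        simp only [v, Pi.smul_apply, smul_eq_mul, mul_pow, Real.sq_sqrt h0,
          Real.sq_sqrt (sub_nonneg.2 h1)]
        ring
      simp_rw [e]
      rw [← Finset.mul_sum]
      refine mul_le_mul ?_ (sum_sq_discrepancy_mulVec_signal_le H π π')
        (Finset.sum_nonneg fun _ _ => sq_nonneg _) (by positivity)
      nlinarith
    calc -(1 / (16 * (p : ℝ))) * (ρ * D / 4) + (1 / (16 * (p : ℝ))) ^ 2 / 2 * ∑ a, v a ^ 2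
        ≤ -(1 / (16 * (p : ℝ))) * (ρ * D / 4) +
            (1 / (16 * (p : ℝ))) ^ 2 / 2 * (4 * ρ * (p * D)) := by gcongr
      _ = -(ρ * D / (128 * p)) := by field_simp; ring
      _ ≤ -(ρ * (M / 2) / (128 * p)) := by gcongr
      _ = -(ρ * M / (256 * p)) := by field_simp; ring
  · have hA : ((1 - ρ) • discrepancy π π').IsHermitian := by
      have h := (isHermitian_discrepancy π π').eq
      rw [Matrix.IsHermitian, Matrix.conjTranspose_smul, h, star_trivial]
    have hK : ∀ x : Weights n p, |x ⬝ᵥ (((1 - ρ) • discrepancy π π') *ᵥ x)| ≤ p * (x ⬝ᵥ x) := by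
      intro x
      rw [Matrix.smul_mulVec, dotProduct_smul, smul_eq_mul, abs_mul,
        abs_of_nonneg (sub_nonneg.2 h1)]
      have := abs_discrepancy_quadratic_le π π' x
      have h2 := abs_nonneg (x ⬝ᵥ (discrepancy π π' *ᵥ x))
      nlinarith
    refine (measureReal_le_quadratic hA ht0 htp hK _).trans (Real.exp_le_exp.2 ?_)
    have hF : ∑ a, ∑ b, ((1 - ρ) • discrepancy π π') a b ^ 2 ≤ 2 * M := by
      simp only [Matrix.smul_apply, smul_eq_mul, mul_pow, ← Finset.mul_sum, sum_sq_discrepancy]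
      have : (1 - ρ) ^ 2 ≤ 1 := by nlinarith
      nlinarith
    rw [Matrix.trace_smul, trace_discrepancy, smul_zero, mul_zero, add_zero]
    calc -t * (ρ * D / 4) + 2 * t ^ 2 * ∑ a, ∑ b, ((1 - ρ) • discrepancy π π') a b ^ 2
        ≤ -t * (ρ * D / 4) + 2 * t ^ 2 * (2 * M) := by gcongr
      -- Using `D ≥ M/2`, the exponent is at most `-tρM/8 + 4t²M`; since `t ≤ ρ/64`, its second term
      -- absorbs at most half of the first.
      _ ≤ -(t * ρ * M / 16) := by
        have h3 : t * ρ * (M / 2) ≤ t * ρ * D := mul_le_mul_of_nonneg_left hDM (by positivity)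
        have h4 : t * t * M ≤ t * (ρ / 64) * M := by gcongr
        linarith

/-! ### Counting misclassified points. -/

/-- The number of misclassified points. -/
def mismatch (π π' : PermTuple n p) : ℕ :=
  ∑ j, (Finset.univ.filter fun u => π j u ≠ π' j u).card

theorem mismatch_relabel (π π' : PermTuple n p) (k : Fin p) :
    mismatch (fun j => (π' k * (π k)⁻¹) * π j) π' = ∑ j, movedNodes (relPerm π π' j k) := by
  refine Finset.sum_congr rfl fun j _ => ?_
  refine Finset.card_bij (fun u _ => π' j u) ?_ (fun a _ b _ h => (π' j).injective h) ?_
  · intro u hu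
    rw [Finset.mem_filter] at hu ⊢
    simpa [relPerm] using hu
  · intro v hv
    refine ⟨(π' j)⁻¹ v, ?_, by simp⟩
    rw [Finset.mem_filter] at hv ⊢
    simpa [relPerm] using hv

/-- For each `k`, optimality is tested against the relabelling `π' k * (π k)⁻¹`, which aligns graph
`k` exactly; its mismatches are the nodes moved by the `relPerm π π' j k`. Summing over `k` recovers
all pairs of graphs. -/
theorem mul_mismatch_le (hn : 4 ≤ n) {π π' : PermTuple n p}
    (hmin : ∀ ψ : Equiv.Perm (Fin n), mismatch π π' ≤ mismatch (fun j => ψ * π j) π') :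
    (n : ℝ) * p * mismatch π π' ≤ 4 * totalMoved π π' := by
  have h : ∀ k, n * mismatch π π' ≤ ∑ j, 4 * movedEdges (relPerm π π' j k) := by
    intro k
    refine (Nat.mul_le_mul_left n (hmin (π' k * (π k)⁻¹))).trans ?_
    rw [mismatch_relabel, Finset.mul_sum]
    exact Finset.sum_le_sum fun j _ => mul_movedNodes_le hn _
  have h2 : p * (n * mismatch π π') ≤ ∑ k : Fin p, ∑ j, 4 * movedEdges (relPerm π π' j k) := by
    simpa using Finset.sum_le_sum (s := (Finset.univ : Finset (Fin p))) fun k _ => h k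
  rw [Finset.sum_comm] at h2
  have h3 : (p : ℝ) * (n * mismatch π π') ≤
      ∑ j : Fin p, ∑ k, 4 * (movedEdges (relPerm π π' j k) : ℝ) := by exact_mod_cast h2
  simp only [← Finset.mul_sum] at h3
  rw [totalMoved]
  linarith

/-- Enlarging the sum from permutations to all maps makes it a product over nodes, each factor being
at most `1 + nq`. -/
theorem sum_pow_card_ne_le {q : ℝ} (hq : 0 ≤ q) (τ : Equiv.Perm (Fin n)) :
    ∑ σ : Equiv.Perm (Fin n), q ^ (Finset.univ.filter fun u => σ u ≠ τ u).card ≤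
      Real.exp (n * (n * q)) := by
  have e : ∀ f : Fin n → Fin n, q ^ (Finset.univ.filter fun u => f u ≠ τ u).card =
      ∏ u, if f u ≠ τ u then q else 1 := by
    intro f
    rw [Finset.prod_ite, Finset.prod_const, Finset.prod_const_one, mul_one]
  calc ∑ σ : Equiv.Perm (Fin n), q ^ (Finset.univ.filter fun u => σ u ≠ τ u).card
      = ∑ f ∈ Finset.univ.map ⟨fun σ : Equiv.Perm (Fin n) => (σ : Fin n → Fin n),
          DFunLike.coe_injective⟩, ∏ u, (if f u ≠ τ u then q else 1) := by
        rw [Finset.sum_map]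
        exact Finset.sum_congr rfl fun σ _ => e σ
    _ ≤ ∑ f : Fin n → Fin n, ∏ u, (if f u ≠ τ u then q else 1) :=
        Finset.sum_le_sum_of_subset_of_nonneg (Finset.subset_univ _) fun f _ _ =>
          Finset.prod_nonneg fun u _ => by split_ifs <;> positivity
    _ = ∏ u, ∑ a, (if a ≠ τ u then q else 1) :=
        (Fintype.prod_sum fun u a => if a ≠ τ u then q else 1).symm
    _ ≤ ∏ _u : Fin n, Real.exp (n * q) := by
        refine Finset.prod_le_prod (fun u _ => Finset.sum_nonneg fun a _ => by
          split_ifs <;> positivity) fun u _ => ?_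
        calc ∑ a, (if a ≠ τ u then q else 1)
            ≤ ∑ a, (q + if a = τ u then 1 else 0) := Finset.sum_le_sum fun a _ => by
              by_cases h : a = τ u <;> simp [h, hq]
          _ = n * q + 1 := by simp [Finset.sum_add_distrib]
          _ ≤ Real.exp (n * q) := Real.add_one_le_exp _
    _ = Real.exp (n * (n * q)) := by simp [← Real.exp_nat_mul]

theorem sum_pow_mismatch_le {q : ℝ} (hq : 0 ≤ q) (π' : PermTuple n p) :
    ∑ π : PermTuple n p, q ^ mismatch π π' ≤ Real.exp (p * (n * (n * q))) := by
  simp only [mismatch, ← Finset.prod_pow_eq_pow_sum]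
  rw [← Fintype.prod_sum fun (j : Fin p) (σ : Equiv.Perm (Fin n)) =>
    q ^ (Finset.univ.filter fun u => σ u ≠ π' j u).card]
  calc _ ≤ ∏ _j : Fin p, Real.exp (n * (n * q)) :=
        Finset.prod_le_prod (fun j _ => Finset.sum_nonneg fun _ _ => by positivity)
          fun j _ => sum_pow_card_ne_le hq (π' j)
    _ = _ := by simp [← Real.exp_nat_mul]

theorem exp_sub_one_le {x : ℝ} (h0 : 0 ≤ x) (h1 : x ≤ 1) : Real.exp x - 1 ≤ 2 * x := by
  have := Real.abs_exp_sub_one_le (x := x) (by rwa [abs_of_nonneg h0])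
  rw [abs_of_nonneg h0] at this
  exact (le_abs_self _).trans this

theorem sum_pow_movedNodes_le {q : ℝ} (hq : 0 ≤ q) (h1 : (n : ℝ) * (n * q) ≤ 1) :
    ∑ σ ∈ Finset.univ.erase (1 : Equiv.Perm (Fin n)), q ^ movedNodes σ ≤ 2 * (n * (n * q)) := by
  have h := sum_pow_card_ne_le hq (1 : Equiv.Perm (Fin n))
  have e : ∀ σ : Equiv.Perm (Fin n),
      (Finset.univ.filter fun u => σ u ≠ (1 : Equiv.Perm (Fin n)) u).card = movedNodes σ :=
    fun _ => rfl
  simp only [e] at h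
  rw [← Finset.add_sum_erase _ _ (Finset.mem_univ (1 : Equiv.Perm (Fin n)))] at h
  have h2 := exp_sub_one_le (by positivity) h1
  have h3 : movedNodes (1 : Equiv.Perm (Fin n)) = 0 := by simp [movedNodes]
  rw [h3, pow_zero] at h
  linarith

/-- The tuple `π'` itself accounts for the term `1`, and `exp x - 1 ≤ 2x` on `[0, 1]` bounds the
rest. -/
theorem sum_pow_mismatch_erase_le {q : ℝ} (hq : 0 ≤ q) (h1 : (p : ℝ) * (n * (n * q)) ≤ 1)
    (π' : PermTuple n p) :
    ∑ π ∈ Finset.univ.erase π', q ^ mismatch π π' ≤ 2 * (p * (n * (n * q))) := by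
  have h := sum_pow_mismatch_le hq π'
  rw [← Finset.add_sum_erase _ _ (Finset.mem_univ π')] at h
  have h2 := exp_sub_one_le (by positivity) h1
  have h3 : mismatch π' π' = 0 := by simp [mismatch]
  rw [h3, pow_zero] at h
  linarith

/-- Union bound over non-identity `σ`: as `σ` moves at least `n/4` edges per moved node, each moved
node contributes a factor `exp(-n/128) ≤ q`. -/
theorem measureReal_compl_goodSignals_le (hn : 4 ≤ n) {q : ℝ} (hq : 0 ≤ q)
    (hnq : Real.exp (-((n : ℝ) / 128)) ≤ q) (h1 : (n : ℝ) * (n * q) ≤ 1) :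
    (stdGaussianFamily (Edge n)).real (goodSignals n)ᶜ ≤ 2 * (n * (n * q)) := by
  have hsub : (goodSignals n)ᶜ ⊆ ⋃ σ ∈ Finset.univ.erase (1 : Equiv.Perm (Fin n)),
      {H | energy H σ ≤ movedEdges σ / 2} := by
    intro H hH
    simp only [goodSignals, Set.mem_compl_iff, Set.mem_ofPred_eq, not_forall, not_le] at hH
    obtain ⟨σ, hσ⟩ := hH
    simp only [Set.mem_iUnion]
    refine ⟨σ, Finset.mem_erase.2 ⟨?_, Finset.mem_univ _⟩, hσ.le⟩
    rintro rfl
    have : movedEdges (1 : Equiv.Perm (Fin n)) = 0 := by simp [movedEdges, edgeMap_one]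
    rw [this] at hσ
    have := energy_nonneg H 1
    simp at hσ
    linarith
  refine (measureReal_mono hsub (measure_ne_top _ _)).trans
    ((measureReal_biUnion_finset_le _ _).trans ?_)
  refine le_trans (Finset.sum_le_sum fun σ _ => ?_) (sum_pow_movedNodes_le hq h1)
  calc _ ≤ Real.exp (-(movedEdges σ / 32)) := measureReal_energy_le σ
    _ ≤ Real.exp (movedNodes σ * -((n : ℝ) / 128)) := by
      apply Real.exp_le_exp.2
      have : (n : ℝ) * movedNodes σ ≤ 4 * movedEdges σ := by
        exact_mod_cast mul_movedNodes_le hn σ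
      linarith
    _ = Real.exp (-((n : ℝ) / 128)) ^ movedNodes σ := Real.exp_nat_mul _ _
    _ ≤ q ^ movedNodes σ := by gcongr

/-! ### Union bound over competitors and the failure event. -/

/-- The alignments, other than the true one, which are optimally labelled with respect to it. -/
def optimallyLabelled (π' : PermTuple n p) : Set (PermTuple n p) :=
  {π | π ≠ π' ∧ ∀ ψ : Equiv.Perm (Fin n), mismatch π π' ≤ mismatch (fun j => ψ * π j) π'}

/-- The signal and noise for which some misaligned tuple does at least as well as the truth. -/
def failureSet (ρ : ℝ) (π' : PermTuple n p) : Set ((Edge n → ℝ) × Weights n p) :=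
  {y | ∃ π ∈ optimallyLabelled π', mleObjective (observation ρ π' y.1 y.2) π' ≤
    mleObjective (observation ρ π' y.1 y.2) π}

theorem measureReal_failure_section_le (hn : 4 ≤ n) (hp : 0 < p) {ρ L : ℝ} (h0 : 0 ≤ ρ)
    (h1 : ρ ≤ 1) (hL : 0 ≤ L) (hρ1 : 10240 * L ≤ ρ * n) (hρ2 : 10240 ^ 2 * L ≤ ρ ^ 2 * (n * p))
    (hq : (p : ℝ) * (n * (n * Real.exp (-(10 * L)))) ≤ 1)
    {H : Edge n → ℝ} (hH : H ∈ goodSignals n) (π' : PermTuple n p) :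
    (stdGaussianFamily (Fin p × Edge n)).real (Prod.mk H ⁻¹' failureSet ρ π') ≤
      4 * (p * (n * (n * Real.exp (-(10 * L))))) := by
  classical
  set q := Real.exp (-(10 * L))
  have hp' : (0 : ℝ) < p := by exact_mod_cast hp
  have hsub : Prod.mk H ⁻¹' failureSet ρ π' ⊆
      ⋃ π ∈ Finset.univ.filter (· ∈ optimallyLabelled π'),
        {Z | mleObjective (observation ρ π' H Z) π' ≤ mleObjective (observation ρ π' H Z) π} := by
    rintro Z ⟨π, hπ, hZ⟩
    simp only [Set.mem_iUnion]
    exact ⟨π, Finset.mem_filter.2 ⟨Finset.mem_univ _, hπ⟩, hZ⟩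
  refine (measureReal_mono hsub (measure_ne_top _ _)).trans
    ((measureReal_biUnion_finset_le _ _).trans ?_)
  have hone : ∀ π ∈ Finset.univ.filter (· ∈ optimallyLabelled π'),
      (stdGaussianFamily (Fin p × Edge n)).real
        {Z | mleObjective (observation ρ π' H Z) π' ≤ mleObjective (observation ρ π' H Z) π} ≤
      2 * q ^ mismatch π π' := by
    intro π hπ
    have hM := mul_mismatch_le hn (Finset.mem_filter.1 hπ).2.2
    set d : ℝ := (mismatch π π' : ℝ) with hd
    have hd0 : 0 ≤ d := Nat.cast_nonneg _
    set M := totalMoved π π'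
    have hqd : q ^ mismatch π π' = Real.exp (-(10 * L * d)) := by
      rw [← Real.exp_nat_mul]; congr 1; rw [hd]; ring
    rw [hqd, two_mul]
    -- The parameter `ρ/64` is optimal in the Frobenius regime; the operator norm `p` caps it at
    -- `1/(4p)`.
    have ht : min (ρ / 64) (1 / (4 * p)) * (p : ℝ) ≤ 1 / 4 := by
      calc min (ρ / 64) (1 / (4 * p)) * (p : ℝ) ≤ 1 / (4 * p) * (p : ℝ) := by
            gcongr; exact min_le_right _ _
        _ = 1 / 4 := by field_simp
    refine (measureReal_mleObjective_le h0 h1 hp hH π π'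
      (le_min (by positivity) (by positivity)) (min_le_left _ _) ht).trans ?_
    refine add_le_add (Real.exp_le_exp.2 (neg_le_neg ?_)) (Real.exp_le_exp.2 (neg_le_neg ?_))
    -- This linear term fixes the constant: `ρM/(256p) ≥ ρnd/1024 ≥ 10Ld` because `10240 = 10 ·
    -- 1024`.
    · rw [le_div_iff₀ (by positivity)]
      have e1 : ρ * (n * p * d) ≤ ρ * (4 * M) := mul_le_mul_of_nonneg_left hM h0
      have e2 : 10240 * L * (p * d) ≤ ρ * n * (p * d) :=
        mul_le_mul_of_nonneg_right hρ1 (by positivity)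
      linarith
    · rcases min_choice (ρ / 64) (1 / (4 * (p : ℝ))) with h | h <;> rw [h]
      -- Only the uncapped case needs the square-root condition on `ρ`: the exponent is `ρ²M/1024`.
      · have e1 : ρ ^ 2 * (n * p * d) ≤ ρ ^ 2 * (4 * M) :=
          mul_le_mul_of_nonneg_left hM (by positivity)
        have e2 : 10240 ^ 2 * L * d ≤ ρ ^ 2 * (n * p) * d := mul_le_mul_of_nonneg_right hρ2 hd0
        have e3 : 0 ≤ L * d := mul_nonneg hL hd0
        nlinarith
      · have e : 1 / (4 * (p : ℝ)) * ρ * M / 16 = ρ * M / (64 * p) := by field_simp; ring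
        rw [e, le_div_iff₀ (by positivity)]
        have e1 : ρ * (n * p * d) ≤ ρ * (4 * M) := mul_le_mul_of_nonneg_left hM h0
        have e2 : 10240 * L * (p * d) ≤ ρ * n * (p * d) :=
          mul_le_mul_of_nonneg_right hρ1 (by positivity)
        have e3 : 0 ≤ L * (p * d) := by positivity
        linarith
  refine (Finset.sum_le_sum hone).trans ?_
  rw [← Finset.mul_sum]
  have hle : ∑ π ∈ Finset.univ.filter (· ∈ optimallyLabelled π'), q ^ mismatch π π' ≤
      ∑ π ∈ Finset.univ.erase π', q ^ mismatch π π' := by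
    refine Finset.sum_le_sum_of_subset_of_nonneg ?_ fun _ _ _ => by positivity
    intro π hπ
    exact Finset.mem_erase.2 ⟨(Finset.mem_filter.1 hπ).2.1, Finset.mem_univ _⟩
  have := sum_pow_mismatch_erase_le (Real.exp_pos _).le hq π'
  linarith

/-- A set all of whose sections have small measure has small measure. -/
theorem measureReal_prod_le {α β : Type*} [MeasurableSpace α] [MeasurableSpace β]
    (μ : Measure α) (ν : Measure β) [IsProbabilityMeasure μ] [IsProbabilityMeasure ν]
    {s : Set (α × β)} (hs : MeasurableSet s) {δ : ℝ} (hδ : 0 ≤ δ)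
    (h : ∀ x, ν.real (Prod.mk x ⁻¹' s) ≤ δ) : (μ.prod ν).real s ≤ δ := by
  rw [Measure.real]
  refine ENNReal.toReal_le_of_le_ofReal hδ ?_
  rw [Measure.prod_apply hs]
  calc ∫⁻ x, ν (Prod.mk x ⁻¹' s) ∂μ ≤ ∫⁻ _, ENNReal.ofReal δ ∂μ :=
        lintegral_mono fun x =>
          (ENNReal.le_ofReal_iff_toReal_le (measure_ne_top _ _) hδ).2 (h x)
    _ = ENNReal.ofReal δ := by simp

theorem measurable_mleObjective (π : PermTuple n p) :
    Measurable fun G : Weights n p => mleObjective G π := by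
  simp only [mleObjective_eq, agreement_quadratic]
  fun_prop

theorem measurableSet_failure (ρ : ℝ) : MeasurableSet
    {ω : PermTuple n p × (Edge n → ℝ) × Weights n p | ω.2 ∈ failureSet ρ ω.1} := by
  have : {ω : PermTuple n p × (Edge n → ℝ) × Weights n p | ω.2 ∈ failureSet ρ ω.1} =
      ⋃ π' : PermTuple n p, ⋃ π ∈ optimallyLabelled π', ({π'} ×ˢ Set.univ) ∩
        {ω | mleObjective (observation ρ ω.1 ω.2.1 ω.2.2) π' ≤
          mleObjective (observation ρ ω.1 ω.2.1 ω.2.2) π} := by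
    ext ω
    simp only [failureSet, Set.mem_ofPred_eq, Set.mem_iUnion, Set.mem_inter_iff, Set.mem_prod,
      Set.mem_singleton_iff, Set.mem_univ, and_true, exists_prop]
    constructor
    · rintro ⟨π, hπ, h⟩
      exact ⟨ω.1, π, hπ, rfl, h⟩
    · rintro ⟨_, π, hπ, rfl, h⟩
      exact ⟨π, hπ, h⟩
  rw [this]
  have hm := (measurable_sampling n p ρ).snd
  refine MeasurableSet.iUnion fun π' => MeasurableSet.biUnion (Set.to_countable _) fun π _ => ?_
  exact ((measurableSet_singleton π').prod MeasurableSet.univ).inter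
    (measurableSet_le ((measurable_mleObjective π').comp hm) ((measurable_mleObjective π).comp hm))

theorem measureReal_failureSet_le (hn : 4 ≤ n) (hp : 0 < p) {ρ L : ℝ} (h0 : 0 ≤ ρ)
    (h1 : ρ ≤ 1) (hL : 0 ≤ L) (hρ1 : 10240 * L ≤ ρ * n) (hρ2 : 10240 ^ 2 * L ≤ ρ ^ 2 * (n * p))
    (hq : (p : ℝ) * (n * (n * Real.exp (-(10 * L)))) ≤ 1) (π' : PermTuple n p) :
    ((stdGaussianFamily (Edge n)).prod (stdGaussianFamily (Fin p × Edge n))).real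
      (failureSet ρ π') ≤ 6 * (p * (n * (n * Real.exp (-(10 * L))))) := by
  set q := Real.exp (-(10 * L)) with hqdef
  have hp1 : (1 : ℝ) ≤ p := by exact_mod_cast hp
  have hq0 : 0 ≤ (n : ℝ) * (n * q) := by positivity
  have hle : (n : ℝ) * (n * q) ≤ p * (n * (n * q)) := le_mul_of_one_le_left hq0 hp1
  have hn0 : (0 : ℝ) ≤ n := Nat.cast_nonneg n
  have hnq : Real.exp (-((n : ℝ) / 128)) ≤ q := by
    apply Real.exp_le_exp.2
    -- As `ρ ≤ 1`, `hρ1` forces `10240 L ≤ n`.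
    nlinarith
  have hmf : MeasurableSet (failureSet ρ π') :=
    measurable_prodMk_left (x := π') (measurableSet_failure ρ)
  have hmg : MeasurableSet (goodSignals n ×ˢ (Set.univ : Set (Weights n p))) :=
    measurableSet_goodSignals.prod MeasurableSet.univ
  have hsub : failureSet ρ π' ⊆ ((goodSignals n)ᶜ ×ˢ Set.univ) ∪
      ((goodSignals n ×ˢ Set.univ) ∩ failureSet ρ π') := by
    intro y hy
    by_cases h : y.1 ∈ goodSignals n
    · exact Or.inr ⟨⟨h, trivial⟩, hy⟩
    · exact Or.inl ⟨h, trivial⟩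
  refine (measureReal_mono hsub).trans ((measureReal_union_le _ _).trans ?_)
  have hA : ((stdGaussianFamily (Edge n)).prod (stdGaussianFamily (Fin p × Edge n))).real
      ((goodSignals n)ᶜ ×ˢ Set.univ) ≤ 2 * (n * (n * q)) := by
    rw [measureReal_prod_prod]
    simpa using measureReal_compl_goodSignals_le hn (Real.exp_pos _).le hnq (hle.trans hq)
  have hB : ((stdGaussianFamily (Edge n)).prod (stdGaussianFamily (Fin p × Edge n))).real
      ((goodSignals n ×ˢ Set.univ) ∩ failureSet ρ π') ≤ 4 * (p * (n * (n * q))) := by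
    refine measureReal_prod_le _ _ (hmg.inter hmf) (by positivity) fun H => ?_
    by_cases h : H ∈ goodSignals n
    · refine (measureReal_mono ?_).trans
        (measureReal_failure_section_le hn hp h0 h1 hL hρ1 hρ2 hq h π')
      exact fun Z hZ => hZ.2
    · have : Prod.mk H ⁻¹' ((goodSignals n ×ˢ (Set.univ : Set (Weights n p))) ∩
          failureSet ρ π') = ∅ := by
        ext Z
        simp [h]
      rw [this, measureReal_empty]
      positivity
  linarith

theorem err_eq_zero_of_mismatch_eq_zero {π π' : PermTuple n p} {ψ : Equiv.Perm (Fin n)}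
    (h : mismatch (fun j => ψ * π j) π' = 0) : err π π' = 0 := by
  have h0 : ∀ u j, ψ (π j u) = π' j u := by
    intro u j
    have := Finset.sum_eq_zero_iff.1 h j (Finset.mem_univ _)
    rw [Finset.card_eq_zero, Finset.filter_eq_empty_iff] at this
    simpa using this (Finset.mem_univ u)
  apply le_antisymm
  · refine (Finset.inf'_le _ (Finset.mem_univ ψ)).trans (le_of_eq ?_)
    simp [h0]
  · refine Finset.le_inf' _ _ fun ψ _ => ?_
    refine mul_nonneg (by positivity) (Finset.sum_nonneg fun u _ => Finset.sum_nonneg fun j _ => ?_)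
    split_ifs <;> norm_num

/-- An optimal relabelling of the estimator keeps its objective value and cannot equal `π'` when the
error is nonzero. The non-strict inequality in `failureSet` covers ties, hence every maximizer. -/
theorem mem_failureSet_of_err_ne_zero {ρ : ℝ} {π' πhat : PermTuple n p}
    {y : (Edge n → ℝ) × Weights n p} (h : IsMLE (observation ρ π' y.1 y.2) πhat)
    (herr : err πhat π' ≠ 0) : y ∈ failureSet ρ π' := by
  obtain ⟨ψ, hψ⟩ := Finite.exists_min fun ψ : Equiv.Perm (Fin n) =>
    mismatch (fun j => ψ * πhat j) π'
  refine ⟨fun j => ψ * πhat j, ⟨fun he => herr ?_, fun φ => ?_⟩, ?_⟩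
  · refine err_eq_zero_of_mismatch_eq_zero (ψ := ψ) ?_
    rw [he]
    simp [mismatch]
  · simpa only [mul_assoc] using hψ (φ * ψ)
  · rw [mleObjective_relabel]
    exact h π'

theorem one_sub_le_modelLaw (ρ : ℝ) {δ : ℝ} (hδ : 0 ≤ δ)
    (h : ∀ π' : PermTuple n p,
      ((stdGaussianFamily (Edge n)).prod (stdGaussianFamily (Fin p × Edge n))).real
        (failureSet ρ π') ≤ δ) :
    1 - δ ≤ (modelLaw n p ρ).real
      {x | ∀ πhat : PermTuple n p, IsMLE x.2 πhat → err πhat x.1 = 0} := by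
  set S := {x : PermTuple n p × Weights n p |
    ∀ πhat : PermTuple n p, IsMLE x.2 πhat → err πhat x.1 = 0}
  set μ := (uniformOn (Set.univ : Set (PermTuple n p))).prod
      ((stdGaussianFamily (Edge n)).prod (stdGaussianFamily (Fin p × Edge n)))
  set F := fun ω : PermTuple n p × (Edge n → ℝ) × Weights n p =>
      (ω.1, observation ρ ω.1 ω.2.1 ω.2.2)
  -- This inequality for the image measure holds for any set, so measurability of `S` is not
  -- required.
  have h1 : μ.real (F ⁻¹' S) ≤ (modelLaw n p ρ).real S :=
    ENNReal.toReal_mono (measure_ne_top _ _)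
      (Measure.le_map_apply (measurable_sampling n p ρ).aemeasurable S)
  have h2 : μ.real {ω | ω.2 ∈ failureSet ρ ω.1} ≤ δ :=
    measureReal_prod_le _ _ (measurableSet_failure ρ) hδ h
  have h3 : (Set.univ : Set (PermTuple n p × (Edge n → ℝ) × Weights n p)) ⊆
      F ⁻¹' S ∪ {ω | ω.2 ∈ failureSet ρ ω.1} := by
    intro ω _
    by_contra hc
    rw [Set.mem_union, not_or] at hc
    refine hc.1 fun πhat hmle => ?_
    by_contra herr
    exact hc.2 (mem_failureSet_of_err_ne_zero hmle herr)
  have h4 := (measureReal_mono (μ := μ) h3).trans (measureReal_union_le _ _)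
  rw [probReal_univ] at h4
  linarith

end GaussianAlignment

/-! ### Choice of constants. -/

theorem corollary1 :
    ∃ (c₁ : ℝ) (n₀ : ℕ), 0 < c₁ ∧
      ∀ (n p : ℕ) (ρ : ℝ), n₀ ≤ n → 2 ≤ p → 0 ≤ ρ → ρ ≤ 1 →
        c₁ * max (Real.log ((n : ℝ) * p) / n) (√(Real.log ((n : ℝ) * p) / ((n : ℝ) * p))) ≤ ρ →
        1 - 1 / ((n : ℝ) * p) ^ 2 ≤
          (GaussianAlignment.modelLaw n p ρ).real
            {x | ∀ πhat : GaussianAlignment.PermTuple n p,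
              GaussianAlignment.IsMLE x.2 πhat → GaussianAlignment.err πhat x.1 = 0} := by
  refine ⟨10240, 4, by norm_num, fun n p ρ hn hp h0 h1 hρ => ?_⟩
  have hn4 : (4 : ℝ) ≤ n := by exact_mod_cast hn
  have hp2 : (2 : ℝ) ≤ p := by exact_mod_cast hp
  set N : ℝ := (n : ℝ) * p with hN
  have hN8 : 8 ≤ N := by nlinarith
  set L := Real.log N
  have hL : 0 ≤ L := Real.log_nonneg (by linarith)
  have hρ1 : 10240 * L ≤ ρ * n := by
    have h := (mul_le_mul_of_nonneg_left (le_max_left (L / n) (√(L / N)))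
      (by norm_num : (0 : ℝ) ≤ 10240)).trans hρ
    rw [← mul_div_assoc, div_le_iff₀ (by linarith)] at h
    exact h
  have hρ2 : 10240 ^ 2 * L ≤ ρ ^ 2 * N := by
    have h := (mul_le_mul_of_nonneg_left (le_max_right (L / n) (√(L / N)))
      (by norm_num : (0 : ℝ) ≤ 10240)).trans hρ
    have h' := pow_le_pow_left₀ (by positivity) h 2
    rw [mul_pow, Real.sq_sqrt (by positivity), ← mul_div_assoc, div_le_iff₀ (by linarith)] at h'
    exact h'
  have hq : Real.exp (-(10 * L)) = (N ^ 10)⁻¹ := by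
    have h : Real.exp (10 * L) = Real.exp L ^ 10 := by
      rw [← Real.exp_nat_mul]
      norm_num
    rw [Real.exp_neg, h, Real.exp_log (by linarith)]
  -- The exponent `10` leaves `N⁻⁸` after the factor `pn² ≤ N²`; the total `6N⁻⁸` is below `N⁻²`
  -- since `N ≥ 8`.
  have hNN : (p : ℝ) * (n * (n * Real.exp (-(10 * L)))) ≤ (N ^ 8)⁻¹ := by
    have h : (p : ℝ) * (n * n) ≤ N ^ 2 := by
      rw [hN]; nlinarith [mul_nonneg (sq_nonneg (n : ℝ)) (show (0 : ℝ) ≤ p * (p - 1) by nlinarith)]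
    calc (p : ℝ) * (n * (n * Real.exp (-(10 * L)))) = p * (n * n) * (N ^ 10)⁻¹ := by
          rw [hq]; ring
      _ ≤ N ^ 2 * (N ^ 10)⁻¹ := by gcongr
      _ = (N ^ 8)⁻¹ := by field_simp
  have hN6 : (6 : ℝ) ≤ N ^ 6 := by
    have := pow_le_pow_left₀ (by norm_num) hN8 6
    linarith
  have hone : (1 : ℝ) ≤ N ^ 8 := one_le_pow₀ (by linarith)
  have hfinal : 6 * (N ^ 8)⁻¹ ≤ 1 / N ^ 2 := by
    calc 6 * (N ^ 8)⁻¹ ≤ N ^ 6 * (N ^ 8)⁻¹ := by gcongr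
      _ = 1 / N ^ 2 := by field_simp
  refine GaussianAlignment.one_sub_le_modelLaw ρ (by positivity) fun π' => ?_
  have := GaussianAlignment.measureReal_failureSet_le hn (by omega) h0 h1 hL hρ1 hρ2
    (hNN.trans (inv_le_one_of_one_le₀ hone)) π'
  linarith
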